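/- Let $M$ be a monoid. Green's relations on $M$ are: $x\,\mathcal L\,y \iff Mx=My$; $x\,\mathcal R\,y\iff xM=yM$; $x\,\mathcal H\,y\iff x\,\mathcal L\,y$ and $x\,\mathcal R\,y$; $x\,\mathcal D\,y\iff$ there is $z\in M$ with $x\,\mathcal L\,z$ and $z\,\mathcal R\,y$. Suppose $M$ is finite. For each $\mathcal D$-class $D$ of $M$ choose a base element $\gamma_D\in D$, let $H$ be the $\mathcal H$-class of $\gamma_D$, and let $G_D$ be the (right) Schützenberger group of $H$, that is, the group of all maps $r_m:H\to H$, $h\mapsto hm$, where $m\in M$ satisfies $Hm\subseteq H$, with multiplication $r_m r_n=r_{mn}$. (Up to isomorphism $G_D$ depends only on $D$.) Let $R$ be a commutative integral domain. An associative unital $R$-algebra $A$ is a cell algebra if there are a finite partially ordered set $\Lambda$, finite sets $L(\lambda),R(\lambda)$ for each $\lambda\in\Lambda$, and an $R$-basis $\{{}_sC_t^\lambda : \lambda\in\Lambda,\ s\in L(\lambda),\ t\in R(\lambda)\}$ of $A$ (indexed injectively by the triples $(\lambda,s,t)$) such that, with $\hat A^\lambda$ the $R$-span of all ${}_sC_t^\mu$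 with $\mu>\lambda$, $s\in L(\mu)$, $t\in R(\mu)$: (i) for all $a\in A$, $\lambda\in\Lambda$, $s\in L(\lambda)$ there are elements $r_{s'}\in R$ $(s'\in L(\lambda))$ such that for every $t\in R(\lambda)$, $a\cdot{}_sC_t^\lambda\equiv\sum_{s'\in L(\lambda)} r_{s'}\,{}_{s'}C_t^\lambda \pmod{\hat A^\lambda}$; (ii) for all $a\in A$, $\lambda\in\Lambda$, $t\in R(\lambda)$ there are elements $r_{t'}\in R$ $(t'\in R(\lambda))$ such that for every $s\in L(\lambda)$, ${}_sC_t^\lambda\cdot a\equiv\sum_{t'\in R(\lambda)} r_{t'}\,{}_sC_{t'}^\lambda \pmod{\hat A^\lambda}$. The monoid $M$ satisfies the $R$-C.A. condition if the group algebra $R[G_D]$ is a cell algebra for every $\mathcal D$-class $D$ of $M$. Corollary 4.5. Let $k$ be a field and let $M$ be a finite monoid which is an inverse semigroup (every $a\in M$ has a unique $b\in M$ with $aba=a$ and $bab=b$) and which satisfies the $k$-C.A. condition. Then the monoid algebra $k[M]$ is semisimple if and only if the group algebra $k[G_D]$ is semisimple for every $\mathcal D$-class $D$ of $M$. -/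

import Mathlib

namespace InvMon

universe u v

section Green

variable {M : Type u} [Monoid M]

/-- Green's relation `L`: `x L y` iff `Mx = My`. -/
def GreenL (x y : M) : Prop :=
  Set.range (fun m : M => m * x) = Set.range (fun m : M => m * y)

/-- Green's relation `R`: `x R y` iff `xM = yM`. -/
def GreenR (x y : M) : Prop :=
  Set.range (fun m : M => x * m) = Set.range (fun m : M => y * m)

/-- Green's relation `H`: the intersection of `L` and `R`. -/
def GreenH (x y : M) : Prop := GreenL x y ∧ GreenR x y

/-- Green's relation `D`: the composite of `L` and `R`. -/
def GreenD (x y : M) : Prop := ∃ z : M, GreenL x z ∧ GreenR z y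

theorem greenL_iff {x y : M} : GreenL x y ↔ (∃ a, a * y = x) ∧ ∃ b, b * x = y := by
  constructor
  · intro h
    have hx : x ∈ Set.range (fun m : M => m * x) := ⟨1, one_mul x⟩
    have hy : y ∈ Set.range (fun m : M => m * y) := ⟨1, one_mul y⟩
    unfold GreenL at h
    rw [h] at hx
    rw [← h] at hy
    exact ⟨hx, hy⟩
  · rintro ⟨⟨a, ha⟩, b, hb⟩
    unfold GreenL
    ext z
    constructor
    · rintro ⟨m, rfl⟩
      exact ⟨m * a, by simp [mul_assoc, ha]⟩
    · rintro ⟨m, rfl⟩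
      exact ⟨m * b, by simp [mul_assoc, hb]⟩

theorem greenR_iff {x y : M} : GreenR x y ↔ (∃ a, y * a = x) ∧ ∃ b, x * b = y := by
  constructor
  · intro h
    have hx : x ∈ Set.range (fun m : M => x * m) := ⟨1, mul_one x⟩
    have hy : y ∈ Set.range (fun m : M => y * m) := ⟨1, mul_one y⟩
    unfold GreenR at h
    rw [h] at hx
    rw [← h] at hy
    exact ⟨hx, hy⟩
  · rintro ⟨⟨a, ha⟩, b, hb⟩
    unfold GreenR
    ext z
    constructor
    · rintro ⟨m, rfl⟩
      exact ⟨a * m, by simp [← mul_assoc, ha]⟩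
    · rintro ⟨m, rfl⟩
      exact ⟨b * m, by simp [← mul_assoc, hb]⟩

/-- The relations `L` and `R` commute. -/
theorem greenL_greenR_comm {x y : M} :
    (∃ z, GreenL x z ∧ GreenR z y) ↔ ∃ z, GreenR x z ∧ GreenL z y := by
  simp only [greenL_iff, greenR_iff]
  constructor
  · rintro ⟨z, ⟨⟨a, ha⟩, b, hb⟩, ⟨d, hd⟩, c, hc⟩
    refine ⟨x * c, ⟨⟨d, ?_⟩, c, rfl⟩, ⟨a, ?_⟩, b, ?_⟩
    · rw [← ha, mul_assoc a, hc, mul_assoc, hd]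
    · rw [← ha, mul_assoc, hc]
    · rw [← mul_assoc, hb, hc]
  · rintro ⟨z, ⟨⟨d, hd⟩, c, hc⟩, ⟨a, ha⟩, b, hb⟩
    refine ⟨b * x, ⟨⟨a, ?_⟩, b, rfl⟩, ⟨d, ?_⟩, c, ?_⟩
    · rw [← hd, ← mul_assoc b, hb, ← mul_assoc, ha]
    · rw [← hd, ← mul_assoc, hb]
    · rw [mul_assoc, hc, hb]

theorem greenD_equivalence : Equivalence (GreenD (M := M)) where
  refl x := ⟨x, rfl, rfl⟩
  symm := by
    rintro x y ⟨z, h1, h2⟩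
    exact greenL_greenR_comm.2 ⟨z, h2.symm, h1.symm⟩
  trans := by
    rintro x y w ⟨z, h1, h2⟩ ⟨t, h3, h4⟩
    obtain ⟨s, h5, h6⟩ := greenL_greenR_comm.2 ⟨y, h2, h3⟩
    exact ⟨s, h1.trans h5, h6.trans h4⟩

variable (M) in
/-- The setoid of Green's relation `D`. -/
def greenDSetoid : Setoid M := ⟨GreenD, greenD_equivalence⟩

variable (M) in
/-- The set of all `D`-classes of `M`. -/
def DClass : Type u := Quotient (greenDSetoid M)

/-- The `D`-class of an element. -/
def DClass.of (x : M) : DClass M := Quotient.mk (greenDSetoid M) x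

/-- The `H`-class of an element. -/
def hClass (γ : M) : Set M := {x | GreenH x γ}

/-- `RT(H) = {m : Hm ⊆ H}` for a subset `H` of `M`. -/
def rightStabilizer (H : Set M) : Submonoid M where
  carrier := {m | ∀ h ∈ H, h * m ∈ H}
  one_mem' := fun h hh => by simpa using hh
  mul_mem' := fun {m n} hm hn h hh => by
    rw [← mul_assoc]
    exact hn _ (hm h hh)

/-- The map `m ↦ r_m`, where `r_m : H → H`, `h ↦ hm`, for `m ∈ RT(H)`. Maps act on the right,
so they are multiplied in the opposite of the usual composition monoid: `r_m r_n = r_{mn}`. -/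
def rightTranslation (H : Set M) : rightStabilizer H →* (Function.End H)ᵐᵒᵖ where
  toFun m := MulOpposite.op fun h => ⟨(h : M) * (m : M), m.2 h h.2⟩
  map_one' := by
    apply MulOpposite.unop_injective
    funext h
    exact Subtype.ext (mul_one (h : M))
  map_mul' m n := by
    apply MulOpposite.unop_injective
    funext h
    exact Subtype.ext (mul_assoc (h : M) (m : M) (n : M)).symm

/-- The (right) Schutzenberger group `{r_m : m ∈ RT(H)}` of the `H`-class `H` of `γ`. -/
def schutzenbergerGroup (γ : M) : Submonoid (Function.End (hClass γ))ᵐᵒᵖ :=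
  MonoidHom.mrange (rightTranslation (hClass γ))

theorem schutzenbergerGroup_isUnit [Finite M] (γ : M) (g : schutzenbergerGroup γ) :
    IsUnit g := by
  obtain ⟨g, m, rfl⟩ := g
  have hinj : Function.Injective (rightTranslation (hClass γ) m).unop := by
    have hγ : γ ∈ hClass γ := ⟨rfl, rfl⟩
    obtain ⟨⟨t, ht⟩, -⟩ := greenR_iff.1 (m.2 γ hγ).2.symm
    have key : ∀ h : hClass γ, (h : M) * (m : M) * t = h := by
      intro h
      obtain ⟨⟨u, hu⟩, -⟩ := greenL_iff.1 h.2.1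
      rw [← hu, mul_assoc u, mul_assoc u, ht]
    intro h h' e
    have e' : (h : M) * (m : M) = (h' : M) * (m : M) := congrArg Subtype.val e
    exact Subtype.ext (by rw [← key h, ← key h', e'])
  have hfin : Finite (schutzenbergerGroup γ) := by
    have : Finite (Function.End (hClass γ)) :=
      inferInstanceAs (Finite (hClass γ → hClass γ))
    have : Finite (Function.End (hClass γ))ᵐᵒᵖ :=
      Finite.of_injective MulOpposite.unop MulOpposite.unop_injective
    exact Subtype.finite
  have hreg : Function.Injective
      (fun x : schutzenbergerGroup γ =>
        x * (⟨rightTranslation (hClass γ) m, m, rfl⟩ : schutzenbergerGroup γ)) := by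
    intro x y e
    apply Subtype.ext
    apply MulOpposite.unop_injective
    funext h
    apply hinj
    exact congrFun (congrArg MulOpposite.unop (congrArg Subtype.val e)) h
  obtain ⟨x, hx⟩ := (Finite.injective_iff_surjective.1 hreg) 1
  have hx' : x * (⟨rightTranslation (hClass γ) m, m, rfl⟩ : schutzenbergerGroup γ) = 1 := hx
  have : IsDedekindFiniteMonoid (schutzenbergerGroup γ) := inferInstance
  exact IsUnit.of_mul_eq_one_right x hx'

/-- The Schutzenberger group of an `H`-class of a finite monoid is a group. -/
noncomputable instance [Finite M] (γ : M) : Group (schutzenbergerGroup γ) :=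
  groupOfIsUnit (schutzenbergerGroup_isUnit γ)

variable (M) in
/-- `M` is an inverse semigroup: every element has a unique inverse. -/
def IsInverse : Prop := ∀ a : M, ∃! b : M, a * b * a = a ∧ b * a * b = b

end Green

section Cell

/-- A cell algebra structure on the `R`-algebra `A`: a finite poset `Λ`, finite sets of left and
right indices, and a basis `C` of `A`, whose member at `⟨l, (s, t)⟩` is `ₛCₜˡ`. -/
structure CellStructure (R : Type u) (A : Type v) [CommRing R] [IsDomain R] [Ring A]
    [Algebra R A] where
  /-- The poset of the cell structure. -/
  Λ : Type
  [order : PartialOrder Λ]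
  [finite : Finite Λ]
  /-- The left indices. -/
  left : Λ → Type
  /-- The right indices. -/
  right : Λ → Type
  [fintypeLeft : ∀ l, Fintype (left l)]
  [fintypeRight : ∀ l, Fintype (right l)]
  /-- The cell basis. -/
  C : Module.Basis (Σ l : Λ, left l × right l) R A
  mul_left : ∀ (a : A) (l : Λ) (s : left l), ∃ r : left l → R, ∀ t : right l,
    a * C ⟨l, (s, t)⟩ - ∑ s' : left l, r s' • C ⟨l, (s', t)⟩ ∈
      Submodule.span R {x : A | ∃ (m : Λ) (p : left m) (q : right m), l < m ∧ x = C ⟨m, (p, q)⟩}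
  mul_right : ∀ (a : A) (l : Λ) (t : right l), ∃ r : right l → R, ∀ s : left l,
    C ⟨l, (s, t)⟩ * a - ∑ t' : right l, r t' • C ⟨l, (s, t')⟩ ∈
      Submodule.span R {x : A | ∃ (m : Λ) (p : left m) (q : right m), l < m ∧ x = C ⟨m, (p, q)⟩}

/-- `A` is a cell algebra over `R`. -/
def IsCellAlgebra (R : Type u) (A : Type v) [CommRing R] [IsDomain R] [Ring A] [Algebra R A] :
    Prop := Nonempty (CellStructure R A)

/-- The `R`-C.A. condition on `M`: for every `D`-class `D` with chosen base element `γ D`, the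
group algebra of the Schutzenberger group `G_D` of the `H`-class of `γ D` is a cell algebra. -/
def CACondition (R : Type u) [CommRing R] [IsDomain R] {M : Type v} [Monoid M]
    (γ : DClass M → M) : Prop :=
  ∀ D : DClass M, IsCellAlgebra R (MonoidAlgebra R (schutzenbergerGroup (γ D)))

end Cell

end InvMon

/-! The algebra `k[M]` is isomorphic to the product over the `D`-classes of the full matrix rings
over `k[G_D]`, with rows and columns indexed by the idempotents of `D`.

Idempotents of `M` commute, so each `a` behaves like a partial bijection from `a⁻¹a` to `aa⁻¹`, and
`L` and `R` compare domains and codomains. The `L`-class of `γ D` is a free right `G_D`-set with one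
orbit per idempotent of `D`. Left multiplication, set to zero whenever it leaves the class, gives
monomial matrices over `k[G_D]` (`schutzRep`). The product of these representations is injective by
a triangularity argument in the natural order, and bijective by counting dimensions
(`schutzProd_bijective`).

Finite products of matrix rings over semisimple rings are semisimple. Conversely each factor is a
quotient, and `isSemisimpleRing_of_matrix` descends from matrices to `k[G_D]` by Maschke's theorem
and its converse. -/

namespace InvMon

universe u v

/-! ### Inverse monoids: commuting idempotents, Green's relations, natural order. -/

section InverseMonoid

/-- A monoid in which every element `a` has a unique inverse `a⁻¹`, in the sense of semigroups. -/
class InverseMonoid (M : Type u) [Monoid M] extends Inv M where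
  mul_inv_mul : ∀ a : M, a * a⁻¹ * a = a
  inv_mul_inv : ∀ a : M, a⁻¹ * a * a⁻¹ = a⁻¹
  eq_inv : ∀ a b : M, a * b * a = a → b * a * b = b → b = a⁻¹

/-- The inverse monoid structure on a monoid which is an inverse semigroup. -/
@[reducible]
noncomputable def IsInverse.inverseMonoid {M : Type u} [Monoid M] (hM : IsInverse M) :
    InverseMonoid M where
  inv a := (hM a).choose
  mul_inv_mul a := (hM a).choose_spec.1.1
  inv_mul_inv a := (hM a).choose_spec.1.2
  eq_inv a b h₁ h₂ := (hM a).choose_spec.2 b ⟨h₁, h₂⟩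

namespace InverseMonoid

variable {M : Type u} [Monoid M] [InverseMonoid M]

theorem inv_invol (a : M) : a⁻¹⁻¹ = a :=
  (eq_inv a⁻¹ a (inv_mul_inv a) (mul_inv_mul a)).symm

theorem inv_of_idem {e : M} (he : e * e = e) : e⁻¹ = e :=
  (eq_inv e e (by rw [he, he]) (by rw [he, he])).symm

/-- With `x` the inverse of `ef`, the element `fxe` is also an inverse of `ef`, hence equals `x`.
This makes `x` idempotent, so its inverse `ef` is `x` itself. -/
theorem idem_mul_idem {e f : M} (he : e * e = e) (hf : f * f = f) :
    e * f * (e * f) = e * f := by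
  have h1 := mul_inv_mul (e * f)
  have h2 := inv_mul_inv (e * f)
  set x := (e * f)⁻¹ with hx
  have key : f * x * e = x := by
    rw [hx]
    apply eq_inv
    · calc e * f * (f * x * e) * (e * f) = e * (f * f) * x * (e * e) * f := by
            simp only [mul_assoc]
        _ = e * f * x * (e * f) := by rw [he, hf]; simp only [mul_assoc]
        _ = e * f := h1
    · calc f * x * e * (e * f) * (f * x * e) = f * (x * (e * e * (f * f)) * x) * e := by
            simp only [mul_assoc]
        _ = f * x * e := by rw [he, hf, h2]
  have hxx : x * x = x := by
    calc x * x = f * x * e * (f * x * e) := by rw [key]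
      _ = f * (x * (e * f) * x) * e := by simp only [mul_assoc]
      _ = x := by rw [h2, key]
  have : e * f = x := by rw [← inv_invol (e * f), ← hx, inv_of_idem hxx]
  rw [this, hxx]

/-- The idempotent `fe` is its own inverse, and `ef` is an inverse of it too. -/
theorem idem_comm {e f : M} (he : e * e = e) (hf : f * f = f) : e * f = f * e := by
  have h1 := idem_mul_idem he hf
  have h2 := idem_mul_idem hf he
  rw [← inv_of_idem h2]
  apply eq_inv
  · calc f * e * (e * f) * (f * e) = f * (e * e) * (f * f) * e := by simp only [mul_assoc]
      _ = f * e * (f * e) := by rw [he, hf]; simp only [mul_assoc]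
      _ = f * e := h2
  · calc e * f * (f * e) * (e * f) = e * (f * f) * (e * e) * f := by simp only [mul_assoc]
      _ = e * f * (e * f) := by rw [he, hf]; simp only [mul_assoc]
      _ = e * f := h1

/-- The domain idempotent `a⁻¹ a`. -/
def dom (a : M) : M := a⁻¹ * a

/-- The codomain idempotent `a a⁻¹`. -/
def cod (a : M) : M := a * a⁻¹

theorem mul_dom (a : M) : a * dom a = a := by
  rw [dom, ← mul_assoc, mul_inv_mul]

theorem cod_mul (a : M) : cod a * a = a := mul_inv_mul a

theorem dom_idem (a : M) : dom a * dom a = dom a := by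
  rw [dom, ← mul_assoc, inv_mul_inv]

theorem cod_idem (a : M) : cod a * cod a = cod a := by
  rw [cod, ← mul_assoc, mul_inv_mul]

theorem dom_inv (a : M) : dom a⁻¹ = cod a := by rw [dom, cod, inv_invol]

theorem cod_inv (a : M) : cod a⁻¹ = dom a := by rw [dom, cod, inv_invol]

theorem mul_inv (a b : M) : (a * b)⁻¹ = b⁻¹ * a⁻¹ := by
  have h := idem_comm (dom_idem a) (cod_idem b)
  symm
  apply eq_inv
  · calc a * b * (b⁻¹ * a⁻¹) * (a * b) = a * (cod b * dom a) * b := by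
          simp only [mul_assoc, dom, cod]
      _ = (a * dom a) * (cod b * b) := by rw [← h]; simp only [mul_assoc]
      _ = a * b := by rw [mul_dom, cod_mul]
  · calc b⁻¹ * a⁻¹ * (a * b) * (b⁻¹ * a⁻¹) = b⁻¹ * (dom a * cod b) * a⁻¹ := by
          simp only [mul_assoc, dom, cod]
      _ = b⁻¹ * b * b⁻¹ * (a⁻¹ * a * a⁻¹) := by rw [h]; simp only [mul_assoc, dom, cod]
      _ = b⁻¹ * a⁻¹ := by rw [inv_mul_inv, inv_mul_inv]

theorem dom_mul (a b : M) : dom (a * b) = b⁻¹ * dom a * b := by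
  simp only [dom, mul_inv, mul_assoc]

theorem dom_mul_of_eq {a b : M} (h : dom a = cod b) : dom (a * b) = dom b := by
  rw [dom_mul, h, mul_assoc, cod_mul, dom]

theorem cod_mul_of_eq {a b : M} (h : dom a = cod b) : cod (a * b) = cod a := by
  rw [← dom_inv, mul_inv, dom_mul_of_eq, dom_inv]
  rw [dom_inv, cod_inv, h]

theorem dom_dom (a : M) : dom (dom a) = dom a := by
  rw [dom, inv_of_idem (dom_idem a), dom_idem]

theorem cod_dom (a : M) : cod (dom a) = dom a := by
  rw [cod, inv_of_idem (dom_idem a), dom_idem]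

theorem dom_mul_dom_mul (a b : M) : dom (a * b) * dom b = dom (a * b) := by
  rw [dom_mul, mul_assoc, mul_dom]

theorem dom_mul_le {a b : M} : dom b * dom (a * b) = dom (a * b) := by
  rw [idem_comm (dom_idem _) (dom_idem _), dom_mul_dom_mul]

theorem greenL_iff_dom {x y : M} : GreenL x y ↔ dom x = dom y := by
  rw [greenL_iff]
  constructor
  · rintro ⟨⟨a, ha⟩, b, hb⟩
    have h1 := dom_mul_dom_mul a y
    have h2 := dom_mul_le (a := b) (b := x)
    rw [ha] at h1
    rw [hb] at h2
    rw [← h1, h2]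
  · intro h
    refine ⟨⟨x * y⁻¹, ?_⟩, y * x⁻¹, ?_⟩
    · rw [mul_assoc]
      change x * dom y = x
      rw [← h, mul_dom]
    · rw [mul_assoc]
      change y * dom x = y
      rw [h, mul_dom]

theorem greenR_iff_cod {x y : M} : GreenR x y ↔ cod x = cod y := by
  rw [← dom_inv, ← dom_inv, ← greenL_iff_dom, greenR_iff, greenL_iff]
  constructor
  · rintro ⟨⟨a, ha⟩, b, hb⟩
    exact ⟨⟨a⁻¹, by rw [← mul_inv, ha]⟩, b⁻¹, by rw [← mul_inv, hb]⟩
  · rintro ⟨⟨a, ha⟩, b, hb⟩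
    exact ⟨⟨a⁻¹, by rw [← inv_invol y, ← mul_inv, ha, inv_invol]⟩,
      b⁻¹, by rw [← inv_invol x, ← mul_inv, hb, inv_invol]⟩

/-- The natural partial order of an inverse monoid, in its strict form. -/
def natLT (s t : M) : Prop := s ≠ t ∧ t * dom s = s

theorem natLT_trans {s t r : M} (h : natLT s t) (h' : natLT t r) : natLT s r := by
  obtain ⟨h1, h2⟩ := h
  obtain ⟨h3, h4⟩ := h'
  -- The domain of a restriction lies below the domain of the element restricted.
  have h5 : dom t * dom s = dom s := by
    have h := dom_mul_le (a := t) (b := dom s)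
    rw [dom_dom, h2] at h
    have : dom s = dom s * dom t * dom s := by
      conv_lhs => rw [← h2, dom_mul, inv_of_idem (dom_idem s)]
    rw [idem_comm (dom_idem t) (dom_idem s)]
    calc dom s * dom t = dom s * dom s * dom t := by rw [dom_idem]
      _ = dom s * dom t * dom s := by
        rw [mul_assoc, mul_assoc, idem_comm (dom_idem t) (dom_idem s)]
      _ = dom s := this.symm
  have h6 : r * dom s = s := by
    calc r * dom s = r * dom t * dom s := by rw [mul_assoc, h5]
      _ = s := by rw [h4, h2]
  refine ⟨?_, h6⟩
  rintro rfl
  apply h1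
  calc s = s * dom s := (mul_dom s).symm
    _ = s * (dom s * dom t) := by rw [idem_comm (dom_idem s) (dom_idem t), h5]
    _ = t := by rw [← mul_assoc, mul_dom, h4]

/-- The order is reversed so that a minimal element is one maximal for the natural order. -/
theorem wellFounded_natGT [Finite M] : WellFounded fun s t : M => natLT t s :=
  haveI : IsTrans M fun s t : M => natLT t s := ⟨fun _ _ _ h h' => natLT_trans h' h⟩
  haveI : Std.Irrefl fun s t : M => natLT t s := ⟨fun _ h => h.1 rfl⟩
  Finite.wellFounded_of_trans_of_irrefl _

end InverseMonoid

end InverseMonoid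

/-! ### The Schützenberger group as a maximal subgroup, and its orbits on an `L`-class. -/

section MaximalSubgroup

open InverseMonoid

variable {M : Type u} [Monoid M] [InverseMonoid M] (c : M)

/-- The maximal subgroup at the domain idempotent of `c`. -/
@[ext]
structure MaximalSubgroup where
  /-- The underlying element. -/
  val : M
  dom_val : dom val = dom c
  cod_val : cod val = dom c

namespace MaximalSubgroup

variable {c}

theorem val_mul_dom (g : MaximalSubgroup c) : g.1 * dom c = g.1 := by
  rw [← g.dom_val, mul_dom]

theorem dom_mul_val (g : MaximalSubgroup c) : dom c * g.1 = g.1 := by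
  conv_lhs => rw [← g.cod_val, cod_mul]

instance : Mul (MaximalSubgroup c) where
  mul g h := ⟨g.1 * h.1, (dom_mul_of_eq (g.dom_val.trans h.cod_val.symm)).trans h.dom_val,
    (cod_mul_of_eq (g.dom_val.trans h.cod_val.symm)).trans g.cod_val⟩

instance : One (MaximalSubgroup c) where
  one := ⟨dom c, dom_dom c, cod_dom c⟩

instance : Inv (MaximalSubgroup c) where
  inv g := ⟨g.1⁻¹, (dom_inv _).trans g.cod_val, (cod_inv _).trans g.dom_val⟩

theorem val_mul (g h : MaximalSubgroup c) : (g * h).1 = g.1 * h.1 := rfl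

theorem val_one : (1 : MaximalSubgroup c).1 = dom c := rfl

instance : Group (MaximalSubgroup c) :=
  Group.ofLeftAxioms (fun g h l => MaximalSubgroup.ext (mul_assoc g.1 h.1 l.1))
    (fun g => MaximalSubgroup.ext (dom_mul_val g)) (fun g => MaximalSubgroup.ext g.dom_val)

instance [Finite M] : Finite (MaximalSubgroup c) :=
  Finite.of_injective MaximalSubgroup.val fun _ _ => MaximalSubgroup.ext

theorem mem_rightStabilizer (g : MaximalSubgroup c) : g.1 ∈ rightStabilizer (hClass c) := by
  rintro h ⟨h1, h2⟩
  rw [greenL_iff_dom] at h1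
  rw [greenR_iff_cod] at h2
  have e : dom h = cod g.1 := h1.trans g.cod_val.symm
  exact ⟨greenL_iff_dom.2 ((dom_mul_of_eq e).trans g.dom_val),
    greenR_iff_cod.2 ((cod_mul_of_eq e).trans h2)⟩

variable (c) in
/-- Right translation, from the maximal subgroup to the Schutzenberger group. -/
def toSchutzenberger : MaximalSubgroup c →* schutzenbergerGroup c where
  toFun g := ⟨rightTranslation (hClass c) ⟨g.1, mem_rightStabilizer g⟩, _, rfl⟩
  map_one' := by
    apply Subtype.ext
    apply MulOpposite.unop_injective
    funext h
    apply Subtype.ext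
    change h.1 * dom c = h.1
    rw [← greenL_iff_dom.1 h.2.1, mul_dom]
  map_mul' g g' := by
    apply Subtype.ext
    exact map_mul (rightTranslation (hClass c)) ⟨g.1, mem_rightStabilizer g⟩
      ⟨g'.1, mem_rightStabilizer g'⟩

theorem toSchutzenberger_bijective : Function.Bijective (toSchutzenberger c) := by
  have hc : c ∈ hClass c := ⟨rfl, rfl⟩
  constructor
  · intro g g' e
    have e1 : c * g.1 = c * g'.1 := congrArg Subtype.val
      (congrFun (congrArg MulOpposite.unop (congrArg Subtype.val e)) ⟨c, hc⟩)
    apply MaximalSubgroup.ext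
    rw [← dom_mul_val g, ← dom_mul_val g', dom, mul_assoc, mul_assoc, e1]
  · rintro ⟨_, m, rfl⟩
    obtain ⟨h1, h2⟩ := m.2 c hc
    rw [greenL_iff_dom] at h1
    rw [greenR_iff_cod] at h2
    have e : dom c⁻¹ = cod (c * m.1) := by rw [h2, dom_inv]
    -- `m` need not lie in the maximal subgroup, but `c⁻¹cm` does, and it acts identically because
    -- `c⁻¹c` fixes the `H`-class from the right.
    refine ⟨⟨c⁻¹ * (c * m.1), (dom_mul_of_eq e).trans h1, (cod_mul_of_eq e).trans (cod_inv c)⟩, ?_⟩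
    apply Subtype.ext
    apply MulOpposite.unop_injective
    funext h
    apply Subtype.ext
    change h.1 * (c⁻¹ * (c * m.1)) = h.1 * m.1
    rw [← mul_assoc c⁻¹, ← mul_assoc]
    change h.1 * dom c * m.1 = _
    rw [← greenL_iff_dom.1 h.2.1, mul_dom]

variable (c) in
/-- The maximal subgroup is isomorphic to the Schutzenberger group. -/
noncomputable def equivSchutzenberger : MaximalSubgroup c ≃* schutzenbergerGroup c :=
  MulEquiv.ofBijective (toSchutzenberger c) toSchutzenberger_bijective

end MaximalSubgroup

/-- The idempotents in the `D`-class of `c`. -/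
@[ext]
structure DIdem where
  /-- The underlying idempotent. -/
  val : M
  exists_cod_eq : ∃ p : M, dom p = dom c ∧ cod p = val

instance [Finite M] : Finite (DIdem c) :=
  Finite.of_injective DIdem.val fun _ _ => DIdem.ext

noncomputable instance [Finite M] : Fintype (DIdem c) := Fintype.ofFinite _

noncomputable instance : DecidableEq (DIdem c) := Classical.decEq _

namespace DIdem

variable {c}

/-- An element with the same domain as `c` and with codomain `i`. -/
noncomputable def rep (i : DIdem c) : M := i.exists_cod_eq.choose

theorem dom_rep (i : DIdem c) : dom i.rep = dom c := i.exists_cod_eq.choose_spec.1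

theorem cod_rep (i : DIdem c) : cod i.rep = i.1 := i.exists_cod_eq.choose_spec.2

theorem dom_rep_eq (i : DIdem c) (g : MaximalSubgroup c) : dom i.rep = cod g.1 :=
  i.dom_rep.trans g.cod_val.symm

theorem dom_rep_mul (i : DIdem c) (g : MaximalSubgroup c) : dom (i.rep * g.1) = dom c :=
  (dom_mul_of_eq (i.dom_rep_eq g)).trans g.dom_val

theorem cod_rep_mul (i : DIdem c) (g : MaximalSubgroup c) : cod (i.rep * g.1) = i.1 :=
  (cod_mul_of_eq (i.dom_rep_eq g)).trans i.cod_rep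

theorem rep_mul_cancel {i : DIdem c} {g h : MaximalSubgroup c}
    (e : i.rep * g.1 = i.rep * h.1) : g = h := by
  apply MaximalSubgroup.ext
  rw [← MaximalSubgroup.dom_mul_val g, ← MaximalSubgroup.dom_mul_val h, ← i.dom_rep, dom,
    mul_assoc, mul_assoc, e]

theorem rep_mul_index {i j : DIdem c} {g h : MaximalSubgroup c}
    (e : i.rep * g.1 = j.rep * h.1) : i = j := by
  apply DIdem.ext
  rw [← i.cod_rep_mul g, e, j.cod_rep_mul h]

/-- The codomain of `x` selects the orbit; the group coordinate is then `i.rep⁻¹ * x`. With the two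
cancellation lemmas this gives unique coordinates on the `L`-class. -/
theorem exists_rep_mul {x : M} (hx : dom x = dom c) :
    ∃ (i : DIdem c) (g : MaximalSubgroup c), x = i.rep * g.1 := by
  let i : DIdem c := ⟨cod x, x, hx, rfl⟩
  have h1 : cod i.rep = cod x := i.cod_rep
  have e : dom i.rep⁻¹ = cod x := by rw [dom_inv, h1]
  refine ⟨i, ⟨i.rep⁻¹ * x, (dom_mul_of_eq e).trans hx, ?_⟩, ?_⟩
  · rw [cod_mul_of_eq e, cod_inv, dom_rep]
  · change x = i.rep * (i.rep⁻¹ * x)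
    rw [← mul_assoc]
    change x = cod i.rep * x
    rw [h1, cod_mul]

end DIdem

end MaximalSubgroup

/-! ### The monomial representations and the decomposition of the monoid algebra. -/

section Representation

open InverseMonoid MonoidAlgebra

variable (k : Type v) [Field k] {M : Type u} [Monoid M] [InverseMonoid M] (c : M)

variable {c} in
open Classical in
/-- The matrix entries of the Schutzenberger representation. -/
noncomputable def schutzEntry (m : M) (i j : DIdem c) : MonoidAlgebra k (MaximalSubgroup c) :=
  if h : ∃ g : MaximalSubgroup c, m * j.rep = i.rep * g.1 then single h.choose 1 else 0

variable {c}

theorem schutzEntry_eq {m : M} {i j : DIdem c} {g : MaximalSubgroup c}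
    (h : m * j.rep = i.rep * g.1) : schutzEntry k m i j = single g 1 := by
  have h' : ∃ g : MaximalSubgroup c, m * j.rep = i.rep * g.1 := ⟨g, h⟩
  rw [schutzEntry, dif_pos h', DIdem.rep_mul_cancel (h'.choose_spec.symm.trans h)]

theorem schutzEntry_eq_zero {m : M} {i j : DIdem c}
    (h : ∀ g : MaximalSubgroup c, m * j.rep ≠ i.rep * g.1) : schutzEntry k m i j = 0 :=
  dif_neg fun ⟨g, hg⟩ => h g hg

theorem schutzEntry_coeff_ne {m : M} {i j : DIdem c} {g : MaximalSubgroup c}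
    (h : m * j.rep ≠ i.rep * g.1) : (schutzEntry k m i j).coeff g = 0 := by
  by_cases h' : ∃ g : MaximalSubgroup c, m * j.rep = i.rep * g.1
  · obtain ⟨g', hg'⟩ := h'
    have : g' ≠ g := by rintro rfl; exact h hg'
    rw [schutzEntry_eq k hg']
    simp [this]
  · rw [schutzEntry_eq_zero k fun g hg => h' ⟨g, hg⟩]
    simp

variable (c) [Finite M]

/-- The left Schutzenberger representation by monomial matrices over the group algebra of the
maximal subgroup. -/
noncomputable def schutzRep :
    M →* Matrix (DIdem c) (DIdem c) (MonoidAlgebra k (MaximalSubgroup c)) where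
  toFun m := Matrix.of (schutzEntry k m)
  map_one' := by
    ext1 i j
    rw [Matrix.of_apply, Matrix.one_apply]
    split_ifs with hij
    · subst hij
      rw [schutzEntry_eq k (g := 1), one_def]
      rw [one_mul, MaximalSubgroup.val_one, ← i.dom_rep, mul_dom]
    · apply schutzEntry_eq_zero
      intro g hg
      apply hij
      apply DIdem.ext
      rw [← i.cod_rep_mul g, ← hg, one_mul, j.cod_rep]
  map_mul' m n := by
    ext1 i j
    rw [Matrix.of_apply, Matrix.mul_apply]
    simp only [Matrix.of_apply]
    by_cases h : ∃ (l : DIdem c) (g : MaximalSubgroup c), n * j.rep = l.rep * g.1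
    · obtain ⟨l, g, hg⟩ := h
      rw [Finset.sum_eq_single l, schutzEntry_eq k hg]
      · by_cases h' : ∃ g' : MaximalSubgroup c, m * l.rep = i.rep * g'.1
        · obtain ⟨g', hg'⟩ := h'
          rw [schutzEntry_eq k hg', single_mul_single, one_mul]
          apply schutzEntry_eq
          rw [mul_assoc, hg, ← mul_assoc, hg', mul_assoc, MaximalSubgroup.val_mul]
        · rw [schutzEntry_eq_zero k (m := m) fun g hg => h' ⟨g, hg⟩, zero_mul]
          apply schutzEntry_eq_zero
          intro x hx
          apply h'
          refine ⟨x * g⁻¹, ?_⟩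
          rw [MaximalSubgroup.val_mul, ← mul_assoc, ← hx, mul_assoc m, hg, mul_assoc, mul_assoc,
            ← MaximalSubgroup.val_mul, mul_inv_cancel, MaximalSubgroup.val_one, ← l.dom_rep,
            mul_dom]
      · intro l' _ hl'
        rw [schutzEntry_eq_zero k (m := n), mul_zero]
        intro g' hg'
        exact hl' (DIdem.rep_mul_index (hg'.symm.trans hg))
      · simp
    · rw [Finset.sum_eq_zero]
      · apply schutzEntry_eq_zero
        intro g hg
        apply h
        apply DIdem.exists_rep_mul
        -- Domains only shrink under left multiplication. If the product with `m` has returned to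
        -- domain `dom c`, then `n * j.rep` never left the `L`-class.
        have h1 : dom (m * (n * j.rep)) = dom c := by
          rw [← mul_assoc, hg, i.dom_rep_mul]
        have h2 := dom_mul_le (a := m) (b := n * j.rep)
        have h3 := dom_mul_dom_mul n j.rep
        rw [h1] at h2
        rw [j.dom_rep] at h3
        rw [← h3, h2]
      · intro l _
        rw [schutzEntry_eq_zero k (m := n), mul_zero]
        exact fun g hg => h ⟨l, g, hg⟩

variable (γ : DClass M → M)

/-- The product of the left Schutzenberger representations over all `D`-classes. -/
noncomputable def schutzProd : MonoidAlgebra k M →ₐ[k]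
    ∀ D : DClass M, Matrix (DIdem (γ D)) (DIdem (γ D)) (MonoidAlgebra k (MaximalSubgroup (γ D))) :=
  AlgHom.pi fun D => MonoidAlgebra.lift k _ M (schutzRep k (γ D))

theorem schutzProd_apply (a : MonoidAlgebra k M) (D : DClass M) (i j : DIdem (γ D)) :
    schutzProd k γ a D i j = a.coeff.sum fun m x => x • schutzEntry k m i j := by
  change MonoidAlgebra.lift k _ M (schutzRep k (γ D)) a i j = _
  rw [lift_apply, Finsupp.sum, Finsupp.sum, Matrix.sum_apply]
  rfl

variable {γ}

/-- For `m` maximal in the support of `a`, some matrix coefficient sees `m` and otherwise only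
elements strictly above `m`, so it equals the coefficient of `m` in `a`. -/
theorem schutzProd_injective (hγ : ∀ D : DClass M, DClass.of (γ D) = D) :
    Function.Injective (schutzProd k γ) := by
  rw [injective_iff_map_eq_zero]
  intro a ha
  by_contra h0
  have hne : {m : M | a.coeff m ≠ 0}.Nonempty := by
    by_contra h
    apply h0
    ext m
    by_contra h'
    exact h ⟨m, h'⟩
  obtain ⟨m, hm, hmax⟩ := wellFounded_natGT.has_min _ hne
  obtain ⟨z, hz1, hz2⟩ : GreenD (γ (DClass.of m)) m := Quotient.exact (hγ (DClass.of m))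
  rw [greenL_iff_dom] at hz1
  rw [greenR_iff_cod] at hz2
  have e1 : dom m⁻¹ = cod z := by rw [dom_inv, hz2]
  -- The column at `dom m` ensures that `m * j.rep` stays in the `L`-class; `m⁻¹ * z` witnesses that
  -- `dom m` belongs to the `D`-class.
  let j : DIdem (γ (DClass.of m)) :=
    ⟨dom m, m⁻¹ * z, (dom_mul_of_eq e1).trans hz1.symm, (cod_mul_of_eq e1).trans (cod_inv m)⟩
  have hj : cod j.rep = dom m := j.cod_rep
  obtain ⟨i, g, hg⟩ := DIdem.exists_rep_mul ((dom_mul_of_eq hj.symm).trans j.dom_rep)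
  have h1 : (schutzProd k γ a (DClass.of m) i j).coeff g = 0 := by
    rw [ha]; simp
  rw [schutzProd_apply, Finsupp.sum, coeff_sum, Finsupp.finsetSum_apply,
    Finset.sum_eq_single m] at h1
  · rw [schutzEntry_eq k hg] at h1
    apply hm
    simpa using h1
  · intro s hs hsm
    by_cases h : s * j.rep = i.rep * g.1
    · exfalso
      -- From `s * j.rep = m * j.rep`, right multiplication by the inverse of `j.rep` gives `s * dom
      -- m = m`, so `m` would lie strictly below `s`.
      apply hmax s (by simpa using hs)
      refine ⟨hsm.symm, ?_⟩
      rw [← hj, cod, ← mul_assoc, h, ← hg, mul_assoc]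
      change m * cod j.rep = m
      rw [hj, mul_dom]
    · rw [coeff_smul, Finsupp.smul_apply, schutzEntry_coeff_ne k h, smul_zero]
  · intro h
    simp [Finsupp.notMem_support_iff.1 h]

/-- Codomain, domain and group coordinate recover the triple. Counting gives the bound of the
dimension of the matrix product by `Nat.card M`. -/
theorem sigma_rep_injective {M : Type u} [Monoid M] [InverseMonoid M] {γ : DClass M → M}
    (hγ : ∀ D : DClass M, DClass.of (γ D) = D) :
    Function.Injective
    fun x : Σ D : DClass M, DIdem (γ D) × DIdem (γ D) × MaximalSubgroup (γ D) =>
      x.2.1.rep * x.2.2.2.1 * (x.2.2.1.rep)⁻¹ := by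
  have hdom : ∀ (D : DClass M) (i j : DIdem (γ D)) (g : MaximalSubgroup (γ D)),
      dom (i.rep * g.1) = cod (j.rep)⁻¹ := by
    intro D i j g
    rw [i.dom_rep_mul, cod_inv, j.dom_rep]
  have hcls : ∀ (D : DClass M) (i j : DIdem (γ D)) (g : MaximalSubgroup (γ D)),
      DClass.of (i.rep * g.1 * (j.rep)⁻¹) = D := by
    intro D i j g
    refine Eq.trans (Quotient.sound (greenD_equivalence.symm ?_)) (hγ D)
    refine ⟨i.rep, greenL_iff_dom.2 i.dom_rep.symm, greenR_iff_cod.2 ?_⟩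
    rw [cod_mul_of_eq (hdom D i j g), i.cod_rep_mul, i.cod_rep]
  rintro ⟨D, i, j, g⟩ ⟨D', i', j', g'⟩ e
  change i.rep * g.1 * (j.rep)⁻¹ = i'.rep * g'.1 * (j'.rep)⁻¹ at e
  obtain rfl : D = D' := by rw [← hcls D i j g, e, hcls]
  have hj : j = j' := by
    apply DIdem.ext
    rw [← j.cod_rep, ← j'.cod_rep, ← dom_inv, ← dom_inv, ← dom_mul_of_eq (hdom D i j g), e,
      dom_mul_of_eq (hdom D i' j' g')]
  subst hj
  have e' : i.rep * g.1 = i'.rep * g'.1 := by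
    have e2 := congrArg (· * j.rep) e
    simp only [mul_assoc] at e2
    change i.rep * (g.1 * dom j.rep) = i'.rep * (g'.1 * dom j.rep) at e2
    rwa [j.dom_rep, g.val_mul_dom, g'.val_mul_dom] at e2
  obtain rfl := DIdem.rep_mul_index e'
  obtain rfl := DIdem.rep_mul_cancel e'
  rfl

theorem schutzProd_bijective (hγ : ∀ D : DClass M, DClass.of (γ D) = D) :
    Function.Bijective (schutzProd k γ) := by
  have : Finite (DClass M) := inferInstanceAs (Finite (Quotient _))
  let : Fintype (DClass M) := Fintype.ofFinite _
  have hinj := schutzProd_injective k hγ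
  have hM : Module.finrank k (MonoidAlgebra k M) = Nat.card M := by
    let : Fintype M := Fintype.ofFinite _
    rw [(coeffLinearEquiv k).finrank_eq, Module.finrank_finsupp_self, Nat.card_eq_fintype_card]
  have hG : ∀ D : DClass M, Module.finrank k (MonoidAlgebra k (MaximalSubgroup (γ D))) =
      Nat.card (MaximalSubgroup (γ D)) := by
    intro D
    let : Fintype (MaximalSubgroup (γ D)) := Fintype.ofFinite _
    rw [(coeffLinearEquiv k).finrank_eq, Module.finrank_finsupp_self, Nat.card_eq_fintype_card]
  have : Module.Finite k (MonoidAlgebra k M) := Module.Finite.equiv (coeffLinearEquiv k).symm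
  have : ∀ D : DClass M, Module.Finite k (MonoidAlgebra k (MaximalSubgroup (γ D))) :=
    fun D => Module.Finite.equiv (coeffLinearEquiv k).symm
  have hle := Nat.card_le_card_of_injective _ (sigma_rep_injective hγ)
  have heq : Module.finrank k (MonoidAlgebra k M) = Module.finrank k (∀ D : DClass M,
      Matrix (DIdem (γ D)) (DIdem (γ D)) (MonoidAlgebra k (MaximalSubgroup (γ D)))) := by
    refine le_antisymm (LinearMap.finrank_le_finrank_of_injective
      (f := (schutzProd k γ).toLinearMap) hinj) ?_
    rw [hM, Module.finrank_pi_fintype]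
    refine le_trans (le_of_eq ?_) hle
    rw [Nat.card_sigma]
    refine Finset.sum_congr rfl fun D _ => ?_
    rw [Module.finrank_matrix, hG, Nat.card_prod, Nat.card_prod, ← Nat.card_eq_fintype_card,
      mul_assoc]
  exact ⟨hinj, (LinearMap.injective_iff_surjective_of_finrank_eq_finrank
    (f := (schutzProd k γ).toLinearMap) heq).1 hinj⟩

end Representation

/-! ### Descent of semisimplicity from matrices to group algebras. -/

section Semisimple

/-- The ideal of `x` is generated by an idempotent `e = ax`, and centrality gives `e = e² = a²x² =
0`. -/
theorem eq_zero_of_central_of_sq_eq_zero {A : Type u} [Ring A] [IsSemisimpleRing A] {x : A}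
    (hx : ∀ a, a * x = x * a) (h0 : x * x = 0) : x = 0 := by
  obtain ⟨e, he, hspan⟩ := IsSemisimpleRing.ideal_eq_span_idempotent (Ideal.span {x})
  have h1 : e ∈ Ideal.span {x} := hspan ▸ Ideal.mem_span_singleton_self e
  have h2 : x ∈ Ideal.span {e} := hspan ▸ Ideal.mem_span_singleton_self x
  obtain ⟨a, rfl⟩ := Ideal.mem_span_singleton'.1 h1
  obtain ⟨b, hb⟩ := Ideal.mem_span_singleton'.1 h2
  have h3 : a * x = 0 := by
    rw [← he.eq, mul_assoc, ← mul_assoc x, ← hx a, mul_assoc a, h0, mul_zero, mul_zero]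
  rw [← hb, h3, mul_zero]

-- If the order of `G` vanished in `k`, the sum `N` of all group elements would be central with `N²
-- = |G|N = 0`, and its scalar matrix would contradict semisimplicity. Otherwise Maschke's theorem
-- applies.
open MonoidAlgebra in
theorem isSemisimpleRing_of_matrix {k : Type v} [Field k] {G : Type u} [Group G] [Finite G]
    {ι : Type*} [Fintype ι] [DecidableEq ι] [Nonempty ι]
    [IsSemisimpleRing (Matrix ι ι (MonoidAlgebra k G))] :
    IsSemisimpleRing (MonoidAlgebra k G) := by
  suffices h : (Nat.card G : k) ≠ 0 by
    have : NeZero (Nat.card G : k) := ⟨h⟩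
    infer_instance
  intro h
  let : Fintype G := Fintype.ofFinite G
  let N : MonoidAlgebra k G := ∑ g : G, single g 1
  have hl : ∀ g : G, single g (1 : k) * N = N := by
    intro g
    simp only [N, Finset.mul_sum, single_mul_single, one_mul]
    exact Fintype.sum_equiv (Equiv.mulLeft g) _ _ fun _ => rfl
  have hr : ∀ g : G, N * single g (1 : k) = N := by
    intro g
    simp only [N, Finset.sum_mul, single_mul_single, one_mul]
    exact Fintype.sum_equiv (Equiv.mulRight g) _ _ fun _ => rfl
  have hc : ∀ a, a * N = N * a := by
    intro a
    induction a using MonoidAlgebra.induction_linear with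
    | zero => simp
    | add a b ha hb => rw [add_mul, mul_add, ha, hb]
    | single g x =>
      have : single g x = x • single g (1 : k) := by simp
      rw [this, smul_mul_assoc, mul_smul_comm, hl, hr]
  have hN : N * N = 0 := by
    conv_lhs => enter [1]; simp only [N]
    rw [Finset.sum_mul, Finset.sum_congr rfl fun g _ => hl g, Finset.sum_const, Finset.card_univ,
      ← Nat.cast_smul_eq_nsmul k, ← Nat.card_eq_fintype_card, h, zero_smul]
  have hS : Matrix.scalar ι N = 0 := by
    apply eq_zero_of_central_of_sq_eq_zero
    · intro A
      exact ((Matrix.scalar_commute N (fun r => (hc r).symm) A).eq).symm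
    · rw [← map_mul, hN, map_zero]
  obtain ⟨i⟩ := ‹Nonempty ι›
  have h1 : N = 0 := by simpa using congrFun (congrFun hS i) i
  have h2 : N.coeff 1 = 0 := by rw [h1]; simp
  simp [N, coeff_sum, Finsupp.finsetSum_apply] at h2

/-- The algebra of a finite inverse monoid is semisimple iff the algebras of all its Schutzenberger
groups are. -/
theorem IsInverse.isSemisimpleRing_monoidAlgebra_iff {k : Type v} [Field k] {M : Type u} [Monoid M]
    [Finite M] (hM : IsInverse M) (γ : DClass M → M) (hγ : ∀ D : DClass M, DClass.of (γ D) = D) :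
    IsSemisimpleRing (MonoidAlgebra k M) ↔
      ∀ D : DClass M, IsSemisimpleRing (MonoidAlgebra k (schutzenbergerGroup (γ D))) := by
  let := hM.inverseMonoid
  have : Finite (DClass M) := inferInstanceAs (Finite (Quotient _))
  have e := RingEquiv.ofBijective (schutzProd k γ) (schutzProd_bijective k hγ)
  have e' (D : DClass M) := (MonoidAlgebra.domCongr k k
    (MaximalSubgroup.equivSchutzenberger (γ D))).toRingEquiv.isSemisimpleRing_iff
  rw [e.isSemisimpleRing_iff]
  constructor
  · intro h D
    rw [← e' D]
    have : Nonempty (DIdem (γ D)) := ⟨⟨_, γ D, rfl, rfl⟩⟩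
    have : IsSemisimpleRing
        (Matrix (DIdem (γ D)) (DIdem (γ D)) (MonoidAlgebra k (MaximalSubgroup (γ D)))) :=
      RingHom.isSemisimpleRing_of_surjective (Pi.evalRingHom (fun D =>
        Matrix (DIdem (γ D)) (DIdem (γ D)) (MonoidAlgebra k (MaximalSubgroup (γ D)))) D) (Function.surjective_eval D)
    exact isSemisimpleRing_of_matrix (ι := DIdem (γ D))
  · intro h
    have (D : DClass M) : IsSemisimpleRing (MonoidAlgebra k (MaximalSubgroup (γ D))) :=
      (e' D).2 (h D)
    infer_instance

end Semisimple

end InvMon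

theorem corollary4p5 {k : Type*} [Field k] {M : Type*} [Monoid M] [Finite M]
    (hM : InvMon.IsInverse M)
    (γ : InvMon.DClass M → M) (hγ : ∀ D : InvMon.DClass M, InvMon.DClass.of (γ D) = D)
    (hCA : InvMon.CACondition k γ) :
    IsSemisimpleRing (MonoidAlgebra k M) ↔
      ∀ D : InvMon.DClass M,
        IsSemisimpleRing (MonoidAlgebra k (InvMon.schutzenbergerGroup (γ D))) :=
  hM.isSemisimpleRing_monoidAlgebra_iff γ hγ
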